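/- Consider a GI/GI/1/1 server with push-out in steady state on the whole time axis: messages arrive at the epochs $(T_n)_{n\in\mathbb Z}$ of a stationary renewal process whose interarrival times are distributed as $X$, with $P(X>0)=1$ and $E X<\infty$; message $n$ requires a service time $S_n$, where the $S_n$ are i.i.d., distributed as $S$, independent of the arrival process, with $P(S>0)=1$ and $E S<\infty$; and $P(X>S)>0$ for independent $X,S$. There is no buffer: an arriving message enters service at once and pushes out the message in service, if there is one, so that message $n$ is successfully transmitted, and then departs at time $T_n+S_n$, if and only if $T_n+S_n<T_{n+1}$. Let $A(t)$ be the largest arrival time that is $\le t$, $D(t)$ the largest departure time that is $\le t$, and $\tilde A(t)$ the largest arrival time $\le t$ of a successfully transmitted message. Let $$\mathsf{AoI}(t)=t-\tilde A(D(t)),\qquad \Delta(t)=A(t)-\tilde A(D(t))$$ be the age of information and the relative age of information. Both are almost surely non-negative, their expectations $\overline{\mathsf{AoI}}=E\,\mathsf{AoI}(t)$ and $\overline\Delta=E\,\Delta(t)$ do not depend on $t\in\mathbb R$, $\overline\Delta$ is finite, and $$\overline{\mathsf{AoI}}=\overline\Delta+\frac{E X^2}{2\,E X}$$ (where both sides are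 $+\infty$ if $E X^2=\infty$). -/

import Mathlib

open MeasureTheory ProbabilityTheory
open scoped ENNReal NNReal

noncomputable section

namespace PushOut

/-! Sample-path quantities of a bufferless server with push-out.  A sample path is a doubly
infinite sequence of arrival epochs `τ n` together with the service requirements `σ n`; message `n`
starts service at once at time `τ n`, and is pushed out if message `n + 1` arrives before it is
done. -/

/-- Message `n` is successfully transmitted: its service ends before the next arrival, i.e.
the service time is smaller than the interarrival time `τ (n + 1) - τ n`. -/
def Departs (τ σ : ℤ → ℝ) (n : ℤ) : Prop := τ n + σ n < τ (n + 1)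

/-- `A(t)`: the largest arrival time that is at most `t`. -/
def lastArrival (τ : ℤ → ℝ) (t : ℝ) : ℝ :=
  sSup {a : ℝ | a ≤ t ∧ ∃ n : ℤ, a = τ n}

/-- `D(t)`: the largest departure time (of a successfully transmitted message) that is at
most `t`. -/
def lastDeparture (τ σ : ℤ → ℝ) (t : ℝ) : ℝ :=
  sSup {d : ℝ | d ≤ t ∧ ∃ n : ℤ, Departs τ σ n ∧ d = τ n + σ n}

/-- `Ã(t)`: the largest arrival time, among successfully transmitted messages, that is at
most `t`. -/
def lastSuccessfulArrival (τ σ : ℤ → ℝ) (t : ℝ) : ℝ :=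
  sSup {a : ℝ | a ≤ t ∧ ∃ n : ℤ, Departs τ σ n ∧ a = τ n}

/-- The (classical) age of information `AoI(t) = t - Ã(D(t))`. -/
def ageOfInformation (τ σ : ℤ → ℝ) (t : ℝ) : ℝ :=
  t - lastSuccessfulArrival τ σ (lastDeparture τ σ t)

/-- The relative age of information `Δ(t) = A(t) - Ã(D(t))`. -/
def relativeAge (τ σ : ℤ → ℝ) (t : ℝ) : ℝ :=
  lastArrival τ t - lastSuccessfulArrival τ σ (lastDeparture τ σ t)

/-- The index of the last arrival that is not later than `s`. -/
def arrivalIndex (τ : ℤ → ℝ) (s : ℝ) : ℤ := sSup {n : ℤ | τ n ≤ s}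

/-- The marked arrival sequence seen from time `s`: the origin of time is moved to `s`, and the
arrivals are renumbered so that number `0` is the last one that is not later than the new origin. -/
def seenFrom (τ σ : ℤ → ℝ) (s : ℝ) : ℤ → ℝ × ℝ := fun n =>
  (τ (n + arrivalIndex τ s) - s, σ (n + arrivalIndex τ s))

/-- The GI/GI input of a single server in steady state, on the whole time axis, with interarrival
law `F` and service law `G`: under `P`, message `n` arrives at time `T n` and requires the service
time `S n`.  As usual for a stationary point process, the numbering is such that
`T 0 ≤ 0 < T 1`.  The law of the one interarrival interval that contains the time origin is not
prescribed (it is not `F` in general): it is determined by stationarity. -/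
structure IsStationaryGIGI {Ω : Type*} [MeasurableSpace Ω] (P : Measure Ω) (F G : Measure ℝ)
    (T S : ℤ → Ω → ℝ) : Prop where
  measurable_arrival : ∀ n, Measurable (T n)
  measurable_service : ∀ n, Measurable (S n)
  /-- Numbering of the arrivals. -/
  origin : ∀ᵐ ω ∂P, T 0 ω ≤ 0 ∧ 0 < T 1 ω
  /-- The interarrival times, except the one containing the origin, have law `F`. -/
  interarrival_law : ∀ n : ℤ, n ≠ 0 → P.map (fun ω => T (n + 1) ω - T n ω) = F
  /-- They are independent. -/
  interarrival_indep :
    iIndepFun (fun (n : {n : ℤ // n ≠ 0}) ω => T ((n : ℤ) + 1) ω - T (n : ℤ) ω) P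
  /-- They are independent of the position of the interval that contains the origin. -/
  origin_indep :
    IndepFun (fun ω => (T 0 ω, T 1 ω))
      (fun ω (n : {n : ℤ // n ≠ 0}) => T ((n : ℤ) + 1) ω - T (n : ℤ) ω) P
  /-- The service times have law `G`. -/
  service_law : ∀ n : ℤ, P.map (S n) = G
  /-- The service times are independent. -/
  service_indep : iIndepFun S P
  /-- The service times are independent of the arrival process. -/
  arrival_service_indep : IndepFun (fun ω n => T n ω) (fun ω n => S n ω) P
  /-- Stationarity: the law of the marked arrival process is invariant under time shifts. -/
  stationary : ∀ s : ℝ,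
    IdentDistrib (fun ω => seenFrom (fun n => T n ω) (fun n => S n ω) s)
      (fun ω n => (T n ω, S n ω)) P P

end PushOut

end

/-!
On a path whose arrivals exhaust the time axis, `AoI(t)` is the sum of `Δ(t)` and of the time
`t - A(t)` elapsed since the last arrival, so the theorem is about two means.

*The elapsed time.*  By stationarity the mean `a` of the elapsed time truncated at `K` does not
depend on `t`, hence by Fubini the integral of the truncated elapsed time over `(0, n E X)` has
mean `n a E X`.  This integral differs by at most `K |T (n + 1) - n E X|`, plus a contribution of
`(0, T 1)` that does not grow with `n`, from the sum over the intervals between `T 1` and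
`T (n + 1)` of the rewards `∫ u in 0..X, min u K`.  Two applications of the strong law of large
numbers, together with dominated convergence, give `a E X = E ∫ u in 0..X, min u K`
(`IsStationaryGIGI.mean_mul_integral_truncElapsed`), and `K → ∞` gives `E X² / (2 E X)`
(`IsStationaryGIGI.lintegral_elapsed`).  The law of the interval that contains the origin is never
needed explicitly.

*The relative age.*  Departures occur in the order of arrivals, so `Ã(D(t))` is the arrival time of
the last message transmitted by time `t`, and `Δ(t)` is a measurable functional, in the form of a
countable infimum, of the path seen from `t` (`IsRegular.relativeAge_spec`); stationarity makes its
mean constant.  At `t = 0`, every successful message with a negative number has departed, so `Δ(0)`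
is at most the sum of the interarrival times met when going back from `T 0` to the first success
(`IsRegular.relativeAgeAtOrigin_le`).  Whether the later messages succeeded is independent of an
interarrival time, so this sum has mean `E X / P(S < X)`, which is finite
(`lintegral_tsum_mul_prod_indicator_lt_top`).
-/

open Filter Topology

noncomputable section

namespace PushOut

/-! ### Sample paths -/

/-- A sequence of arrival epochs that increases strictly and exhausts the time axis in both
directions. -/
structure IsRegular (τ : ℤ → ℝ) : Prop where
  strictMono : StrictMono τ
  tendsto_atTop : Tendsto τ atTop atTop
  tendsto_atBot : Tendsto τ atBot atBot

/-- The time elapsed at `t` since the last arrival, written as a countable infimum, so that it is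
visibly measurable in `τ` and `t` jointly. -/
def elapsed (τ : ℤ → ℝ) (t : ℝ) : ℝ≥0∞ :=
  ⨅ n : ℤ, if τ n ≤ t then ENNReal.ofReal (t - τ n) else ∞

/-- The relative age at the time origin of a marked arrival sequence whose arrival number `0` is
the last one before the origin.  It is written as a countable infimum over the messages that have
departed by time `0`, hence is measurable; it is `∞` if there is no such message. -/
def relativeAgeAtOrigin (y : ℤ → ℝ × ℝ) : ℝ≥0∞ :=
  ⨅ n : ℤ, if (y n).1 + (y n).2 < (y (n + 1)).1 ∧ (y n).1 + (y n).2 ≤ 0 then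
    ENNReal.ofReal ((y 0).1 - (y n).1) else ∞

lemma measurable_elapsed {α : Type*} [MeasurableSpace α] {τ : ℤ → α → ℝ} {t : α → ℝ}
    (hτ : ∀ n, Measurable (τ n)) (ht : Measurable t) :
    Measurable fun a => elapsed (fun n => τ n a) (t a) := by
  refine Measurable.iInf fun n => Measurable.ite (measurableSet_le (hτ n) ht) ?_ measurable_const
  exact (ht.sub (hτ n)).ennreal_ofReal

lemma measurable_relativeAgeAtOrigin : Measurable relativeAgeAtOrigin := by
  have h1 (n : ℤ) : Measurable fun y : ℤ → ℝ × ℝ => (y n).1 := (measurable_pi_apply n).fst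
  have h2 (n : ℤ) : Measurable fun y : ℤ → ℝ × ℝ => (y n).2 := (measurable_pi_apply n).snd
  refine Measurable.iInf fun n => Measurable.ite ?_ ?_ measurable_const
  · exact (measurableSet_lt ((h1 n).add (h2 n)) (h1 (n + 1))).inter
      (measurableSet_le ((h1 n).add (h2 n)) measurable_const)
  · exact ((h1 0).sub (h1 n)).ennreal_ofReal

variable {τ σ : ℤ → ℝ} {t : ℝ}

lemma IsRegular.arrivalIndex_spec (h : IsRegular τ) (t : ℝ) :
    τ (arrivalIndex τ t) ≤ t ∧ t < τ (arrivalIndex τ t + 1) := by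
  have hne : {n : ℤ | τ n ≤ t}.Nonempty := (h.tendsto_atBot.eventually_le_atBot t).exists
  have hbdd : BddAbove {n : ℤ | τ n ≤ t} := by
    obtain ⟨N, hN⟩ := (h.tendsto_atTop.eventually_gt_atTop t).exists
    refine ⟨N, fun n (hn : τ n ≤ t) => ?_⟩
    exact (h.strictMono.lt_iff_lt.1 (hn.trans_lt hN)).le
  refine ⟨Int.csSup_mem hne hbdd, ?_⟩
  by_contra! hlt
  have := le_csSup hbdd (show arrivalIndex τ t + 1 ∈ {n : ℤ | τ n ≤ t} from hlt)
  change arrivalIndex τ t + 1 ≤ arrivalIndex τ t at this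
  omega

lemma IsRegular.lastArrival_eq (h : IsRegular τ) (t : ℝ) :
    lastArrival τ t = τ (arrivalIndex τ t) := by
  obtain ⟨h1, h2⟩ := h.arrivalIndex_spec t
  refine IsGreatest.csSup_eq ⟨⟨h1, _, rfl⟩, ?_⟩
  rintro _ ⟨ha, n, rfl⟩
  have := h.strictMono.lt_iff_lt.1 (ha.trans_lt h2)
  exact h.strictMono.monotone (by omega)

lemma elapsed_eq (hτ : StrictMono τ) {n : ℤ} (h1 : τ n ≤ t) (h2 : t < τ (n + 1)) :
    elapsed τ t = ENNReal.ofReal (t - τ n) := by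
  refine le_antisymm ((iInf_le _ n).trans (by rw [if_pos h1])) (le_iInf fun k => ?_)
  split_ifs with hk
  · have := hτ.lt_iff_lt.1 (hk.trans_lt h2)
    have := hτ.monotone (show k ≤ n by omega)
    exact ENNReal.ofReal_le_ofReal (by linarith)
  · exact le_top

/-- As departures occur in the order of arrivals, the message behind `Ã(D(t))` is the last one
that has been transmitted by time `t`. -/
lemma IsRegular.lastSuccessfulArrival_lastDeparture (h : IsRegular τ) (hσ : ∀ n, 0 < σ n)
    (hdep : ∃ n, Departs τ σ n ∧ τ n + σ n ≤ t) :
    ∃ N, (Departs τ σ N ∧ τ N + σ N ≤ t) ∧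
      lastSuccessfulArrival τ σ (lastDeparture τ σ t) = τ N ∧
      ∀ n, Departs τ σ n → τ n + σ n ≤ t → n ≤ N := by
  have hbdd : BddAbove {n | Departs τ σ n ∧ τ n + σ n ≤ t} := by
    refine ⟨arrivalIndex τ t, fun n hn => ?_⟩
    have := h.strictMono.lt_iff_lt.1 ((show τ n ≤ t by linarith [hn.2, hσ n]).trans_lt
      (h.arrivalIndex_spec t).2)
    omega
  have hmem := Int.csSup_mem hdep hbdd
  set N := sSup {n | Departs τ σ n ∧ τ n + σ n ≤ t}
  have hmax : ∀ n, Departs τ σ n → τ n + σ n ≤ t → n ≤ N := fun n h1 h2 =>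
    le_csSup hbdd ⟨h1, h2⟩
  have hD : lastDeparture τ σ t = τ N + σ N := by
    refine IsGreatest.csSup_eq ⟨⟨hmem.2, N, hmem.1, rfl⟩, ?_⟩
    rintro _ ⟨hd, n, hn, rfl⟩
    rcases (hmax n hn hd).eq_or_lt with rfl | hlt
    · exact le_rfl
    · have h1 : τ n + σ n < τ (n + 1) := hn
      have h2 : τ (n + 1) ≤ τ N := h.strictMono.monotone (by omega)
      linarith [hσ N]
  refine ⟨N, hmem, ?_, hmax⟩
  rw [hD]
  refine IsGreatest.csSup_eq ⟨⟨by linarith [hσ N], N, hmem.1, rfl⟩, ?_⟩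
  rintro _ ⟨ha, n, -, rfl⟩
  by_contra! hlt
  have h1 : τ (N + 1) ≤ τ n := h.strictMono.monotone (by
    have := h.strictMono.lt_iff_lt.1 hlt; omega)
  have h2 : τ N + σ N < τ (N + 1) := hmem.1
  linarith

lemma relativeAgeAtOrigin_seenFrom (τ σ : ℤ → ℝ) (t : ℝ) :
    relativeAgeAtOrigin (seenFrom τ σ t) =
      ⨅ n : ℤ, if τ n + σ n < τ (n + 1) ∧ τ n + σ n ≤ t then
        ENNReal.ofReal (τ (arrivalIndex τ t) - τ n) else ∞ := by
  rw [relativeAgeAtOrigin, ← (Equiv.subRight (arrivalIndex τ t)).iInf_comp]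
  refine iInf_congr fun n => ?_
  simp only [seenFrom, Equiv.subRight_apply, zero_add, sub_add_cancel]
  congr 1
  · rw [show n - arrivalIndex τ t + 1 + arrivalIndex τ t = n + 1 by ring]
    refine propext (and_congr ⟨fun h => by linarith, fun h => by linarith⟩
      ⟨fun h => by linarith, fun h => by linarith⟩)
  · congr 1
    ring

lemma exists_departs_of_relativeAgeAtOrigin_ne_top
    (hfin : relativeAgeAtOrigin (seenFrom τ σ t) ≠ ∞) :
    ∃ n, Departs τ σ n ∧ τ n + σ n ≤ t := by
  by_contra! hno
  refine hfin ?_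
  rw [relativeAgeAtOrigin_seenFrom, iInf_eq_top]
  exact fun n => if_neg fun hn => (hno n hn.1).not_ge hn.2

/-- On a regular path with at least one departure before `t`, the relative age is a measurable
functional of the path seen from `t`. -/
lemma IsRegular.relativeAge_spec (h : IsRegular τ) (hσ : ∀ n, 0 < σ n)
    (hfin : relativeAgeAtOrigin (seenFrom τ σ t) ≠ ∞) :
    0 ≤ relativeAge τ σ t ∧
      ENNReal.ofReal (relativeAge τ σ t) = relativeAgeAtOrigin (seenFrom τ σ t) := by
  obtain ⟨N, hN, hA, hmax⟩ := h.lastSuccessfulArrival_lastDeparture hσ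
    (exists_departs_of_relativeAgeAtOrigin_ne_top hfin)
  rw [relativeAgeAtOrigin_seenFrom, relativeAge, hA, h.lastArrival_eq]
  constructor
  · have := h.strictMono.lt_iff_lt.1 ((show τ N ≤ t by linarith [hN.2, hσ N]).trans_lt
      (h.arrivalIndex_spec t).2)
    exact sub_nonneg.2 (h.strictMono.monotone (by omega))
  · refine le_antisymm (le_iInf fun n => ?_) ((iInf_le _ N).trans (if_pos hN).le)
    split_ifs with hn
    · have := h.strictMono.monotone (hmax n hn.1 hn.2)
      exact ENNReal.ofReal_le_ofReal (by linarith)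
    · exact le_top

lemma IsRegular.elapsed_seenFrom (h : IsRegular τ) (σ : ℤ → ℝ) (t : ℝ) :
    elapsed τ t = ENNReal.ofReal (-(seenFrom τ σ t 0).1) := by
  obtain ⟨h1, h2⟩ := h.arrivalIndex_spec t
  rw [elapsed_eq h.strictMono h1 h2]
  simp [seenFrom]

/-- The age of information exceeds the relative age by the time elapsed since the last arrival. -/
lemma IsRegular.ageOfInformation_spec (h : IsRegular τ) (hrel : 0 ≤ relativeAge τ σ t) :
    0 ≤ ageOfInformation τ σ t ∧
      ENNReal.ofReal (ageOfInformation τ σ t) =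
        ENNReal.ofReal (relativeAge τ σ t) + elapsed τ t := by
  obtain ⟨h1, h2⟩ := h.arrivalIndex_spec t
  have hsum : ageOfInformation τ σ t = relativeAge τ σ t + (t - τ (arrivalIndex τ t)) := by
    rw [ageOfInformation, relativeAge, h.lastArrival_eq]
    ring
  rw [hsum, elapsed_eq h.strictMono h1 h2, ENNReal.ofReal_add hrel (by linarith)]
  exact ⟨by linarith, rfl⟩

/-- `∫ u in 0..x, min u K`: the integral of the truncated elapsed time over an interarrival
interval of length `x`. -/
def truncReward (K x : ℝ) : ℝ := ∫ u in (0 : ℝ)..x, min u K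

lemma intervalIntegrable_min_const (K a b : ℝ) :
    IntervalIntegrable (fun u : ℝ => min u K) volume a b :=
  (continuous_id.min continuous_const).intervalIntegrable a b

lemma continuous_truncReward (K : ℝ) : Continuous (truncReward K) :=
  intervalIntegral.continuous_primitive (intervalIntegrable_min_const K) 0

lemma truncReward_nonneg {K x : ℝ} (hK : 0 ≤ K) (hx : 0 ≤ x) : 0 ≤ truncReward K x :=
  intervalIntegral.integral_nonneg hx fun _ hu => le_min hu.1 hK

lemma truncReward_le {K x : ℝ} (hx : 0 ≤ x) : truncReward K x ≤ K * x := by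
  calc truncReward K x ≤ ∫ _ in (0 : ℝ)..x, K :=
        intervalIntegral.integral_mono_on hx (intervalIntegrable_min_const K 0 x)
          intervalIntegrable_const fun _ _ => min_le_right _ K
    _ = K * x := by simp [mul_comm]

lemma truncReward_mono {K K' x : ℝ} (hK : K ≤ K') (hx : 0 ≤ x) :
    truncReward K x ≤ truncReward K' x :=
  intervalIntegral.integral_mono_on hx (intervalIntegrable_min_const K 0 x)
    (intervalIntegrable_min_const K' 0 x) fun _ _ => min_le_min_left _ hK

lemma truncReward_eq {K x : ℝ} (hx : 0 ≤ x) (hK : x ≤ K) : truncReward K x = x ^ 2 / 2 := by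
  rw [truncReward, intervalIntegral.integral_congr (g := fun u => u)]
  · simp [integral_id]
  · intro u hu
    rw [Set.uIcc_of_le hx] at hu
    exact min_eq_left (hu.2.trans hK)

/-- The time elapsed since the last arrival, truncated at `K`, as a real number. -/
def truncElapsed (K : ℝ) (τ : ℤ → ℝ) (t : ℝ) : ℝ := (min (elapsed τ t) (ENNReal.ofReal K)).toReal

lemma truncElapsed_nonneg (K : ℝ) (τ : ℤ → ℝ) (t : ℝ) : 0 ≤ truncElapsed K τ t :=
  ENNReal.toReal_nonneg

lemma truncElapsed_le {K : ℝ} (hK : 0 ≤ K) (τ : ℤ → ℝ) (t : ℝ) : truncElapsed K τ t ≤ K := by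
  refine (ENNReal.toReal_mono ENNReal.ofReal_ne_top (min_le_right _ _)).trans ?_
  rw [ENNReal.toReal_ofReal hK]

lemma ofReal_truncElapsed (K : ℝ) (τ : ℤ → ℝ) (t : ℝ) :
    ENNReal.ofReal (truncElapsed K τ t) = min (elapsed τ t) (ENNReal.ofReal K) :=
  ENNReal.ofReal_toReal (ne_top_of_le_ne_top ENNReal.ofReal_ne_top (min_le_right _ _))

lemma measurable_truncElapsed (K : ℝ) {α : Type*} [MeasurableSpace α] {τ : ℤ → α → ℝ} {t : α → ℝ}
    (hτ : ∀ n, Measurable (τ n)) (ht : Measurable t) :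
    Measurable fun a => truncElapsed K (fun n => τ n a) (t a) :=
  ((measurable_elapsed hτ ht).min measurable_const).ennreal_toReal

lemma intervalIntegrable_truncElapsed {K : ℝ} (hK : 0 ≤ K) (τ : ℤ → ℝ) (a b : ℝ) :
    IntervalIntegrable (truncElapsed K τ) volume a b := by
  refine (intervalIntegrable_const (c := K)).mono_fun
    (measurable_truncElapsed K (τ := fun n _ => τ n) (fun _ => measurable_const)
      measurable_id).aestronglyMeasurable (ae_of_all _ fun t => ?_)
  beta_reduce
  rw [Real.norm_of_nonneg (truncElapsed_nonneg K τ t), Real.norm_of_nonneg hK]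
  exact truncElapsed_le hK τ t

lemma integral_truncElapsed_interarrival {K : ℝ} (hK : 0 ≤ K) (hτ : StrictMono τ) (n : ℤ) :
    ∫ t in τ n..τ (n + 1), truncElapsed K τ t = truncReward K (τ (n + 1) - τ n) := by
  have hle : τ n ≤ τ (n + 1) := hτ.monotone (by omega)
  have h1 : ∫ t in τ n..τ (n + 1), truncElapsed K τ t = ∫ t in τ n..τ (n + 1), min (t - τ n) K := by
    refine intervalIntegral.integral_congr_ae ?_
    -- the end point `τ (n + 1)`, at which the elapsed time jumps to `0`, is negligible
    filter_upwards [compl_mem_ae_iff.2 (measure_singleton (τ (n + 1)))] with t ht hmem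
    rw [Set.uIoc_of_le hle] at hmem
    have hlt : t < τ (n + 1) := lt_of_le_of_ne hmem.2 ht
    rw [truncElapsed, elapsed_eq hτ hmem.1.le hlt, ← ENNReal.ofReal_min,
      ENNReal.toReal_ofReal (le_min (by linarith [hmem.1]) hK)]
  rw [h1, intervalIntegral.integral_comp_sub_right (fun u => min u K), sub_self, truncReward]

lemma integral_truncElapsed_eq_sum {K : ℝ} (hK : 0 ≤ K) (hτ : StrictMono τ) (n : ℕ) :
    ∫ t in τ 1..τ (n + 1), truncElapsed K τ t =
      ∑ k ∈ Finset.range n, truncReward K (τ ((k + 1 : ℤ) + 1) - τ (k + 1)) := by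
  have := intervalIntegral.sum_integral_adjacent_intervals (μ := volume)
    (f := truncElapsed K τ) (a := fun k : ℕ => τ (k + 1)) (n := n)
    fun k _ => intervalIntegrable_truncElapsed hK τ _ _
  simp only [Nat.cast_zero, zero_add] at this
  rw [← this]
  refine Finset.sum_congr rfl fun k _ => ?_
  push_cast
  exact integral_truncElapsed_interarrival hK hτ (k + 1)

end PushOut

/-! ### Independence of pairs -/

/-- Two mutually independent families, independent of each other, form a family of independent
pairs. -/
lemma ProbabilityTheory.iIndepFun.prodMk_of_indepFun {Ω ι α β : Type*} [MeasurableSpace Ω]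
    [MeasurableSpace α] [MeasurableSpace β] {P : Measure Ω} {X : ι → Ω → α} {Y : ι → Ω → β}
    (hX : iIndepFun X P) (hY : iIndepFun Y P) (mX : ∀ i, Measurable (X i))
    (mY : ∀ i, Measurable (Y i)) (hXY : IndepFun (fun ω i => X i ω) (fun ω i => Y i ω) P) :
    iIndepFun (fun i ω => (X i ω, Y i ω)) P := by
  have := hX.isProbabilityMeasure
  rw [iIndepFun_iff_finset]
  intro s
  have hpair (i : s) : P.map (fun ω => (X i ω, Y i ω)) = (P.map (X i)).prod (P.map (Y i)) :=
    (hXY.comp (measurable_pi_apply (i : ι)) (measurable_pi_apply (i : ι))).map_prod_eq_prod_map_map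
      (mX i).aemeasurable (mY i).aemeasurable
  have hvec : P.map (fun ω => ((fun i : s => X i ω), (fun i : s => Y i ω))) =
      (Measure.pi fun i : s => P.map (X i)).prod (Measure.pi fun i : s => P.map (Y i)) := by
    have hind : IndepFun (fun ω (i : s) => X i ω) (fun ω (i : s) => Y i ω) P :=
      hXY.comp (s.measurable_restrict (X := fun _ => α)) (s.measurable_restrict (X := fun _ => β))
    have hX' : P.map (fun ω (i : s) => X i ω) = Measure.pi fun i : s => P.map (X i) :=
      (hX.restrict s).map_fun_eq_pi_map fun i : s => (mX i).aemeasurable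
    have hY' : P.map (fun ω (i : s) => Y i ω) = Measure.pi fun i : s => P.map (Y i) :=
      (hY.restrict s).map_fun_eq_pi_map fun i : s => (mY i).aemeasurable
    rw [hind.map_prod_eq_prod_map_map (by fun_prop) (by fun_prop), hX', hY']
  have : ∀ i, IsProbabilityMeasure (P.map (X i)) := fun i =>
    Measure.isProbabilityMeasure_map (mX i).aemeasurable
  have : ∀ i, IsProbabilityMeasure (P.map (Y i)) := fun i =>
    Measure.isProbabilityMeasure_map (mY i).aemeasurable
  change iIndepFun (fun (i : s) ω => (X i ω, Y i ω)) P
  rw [iIndepFun_iff_map_fun_eq_pi_map fun i : s => ((mX i).prodMk (mY i)).aemeasurable]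
  have hmp := measurePreserving_arrowProdEquivProdArrow α β s (fun i => P.map (X i))
    (fun i => P.map (Y i))
  have h2 := (hmp.symm _).map_eq
  rw [← hvec, Measure.map_map (MeasurableEquiv.measurable _) (by fun_prop)] at h2
  change P.map (fun ω (i : s) => (X i ω, Y i ω)) =
    Measure.pi fun i : s => P.map (fun ω => (X i ω, Y i ω))
  simp_rw [hpair]
  exact h2

namespace PushOut

/-! ### Stopping at the first success -/

/-- Wald's identity for the first success: with `ζ = P(S < X) > 0`, the sum over `k` of `X k` on
the event that none of the pairs before the `k`-th is a success has finite mean, namely `E X / ζ`,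
by independence and the geometric series. -/
lemma lintegral_tsum_mul_prod_indicator_lt_top {Ω : Type*} [MeasurableSpace Ω] {P : Measure Ω}
    {F G : Measure ℝ} [IsProbabilityMeasure F] [IsProbabilityMeasure G]
    (hF_mean : Integrable (fun x : ℝ => x) F)
    (hζ : 0 < (F.prod G) {p : ℝ × ℝ | p.2 < p.1}) {Z : ℕ → Ω → ℝ × ℝ}
    (hZ : iIndepFun Z P) (mZ : ∀ k, Measurable (Z k)) (hlaw : ∀ k, P.map (Z k) = F.prod G) :
    ∫⁻ ω, ∑' k, (∏ i ∈ Finset.range k, {p : ℝ × ℝ | p.1 ≤ p.2}.indicator 1 (Z i ω)) *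
      ENNReal.ofReal (Z k ω).1 ∂P < ∞ := by
  have hmeas : MeasurableSet {p : ℝ × ℝ | p.1 ≤ p.2} :=
    measurableSet_le measurable_fst measurable_snd
  have hind : Measurable ({p : ℝ × ℝ | p.1 ≤ p.2}.indicator (1 : ℝ × ℝ → ℝ≥0∞)) :=
    measurable_one.indicator hmeas
  have hfst : Measurable fun p : ℝ × ℝ => ENNReal.ofReal p.1 := measurable_fst.ennreal_ofReal
  set q := (F.prod G) {p : ℝ × ℝ | p.1 ≤ p.2} with hq
  have hq1 : q < 1 := by
    have hcompl : {p : ℝ × ℝ | p.1 ≤ p.2}ᶜ = {p : ℝ × ℝ | p.2 < p.1} := by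
      ext p; simp
    have := prob_add_prob_compl (μ := F.prod G) hmeas
    rw [hcompl] at this
    rw [← this]
    exact ENNReal.lt_add_right (measure_ne_top _ _) hζ.ne'
  have hterm (k : ℕ) :
      ∫⁻ ω, (∏ i ∈ Finset.range k, {p : ℝ × ℝ | p.1 ≤ p.2}.indicator 1 (Z i ω)) *
        ENNReal.ofReal (Z k ω).1 ∂P = q ^ k * ∫⁻ x, ENNReal.ofReal x ∂F := by
    let f : ℕ → ℝ × ℝ → ℝ≥0∞ := fun i =>
      if i = k then fun p => ENNReal.ofReal p.1 else {p : ℝ × ℝ | p.1 ≤ p.2}.indicator 1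
    have hf (i : ℕ) : Measurable (f i) := by
      by_cases h : i = k <;> simp only [f, h, if_true, if_false] <;> assumption
    have hprod := lintegral_prod_eq_prod_lintegral_of_indepFun (Finset.range (k + 1))
      (fun i => f i ∘ Z i) (hZ.comp f hf) fun i => (hf i).comp (mZ i)
    have hne : ∀ i ∈ Finset.range k, f i = {p : ℝ × ℝ | p.1 ≤ p.2}.indicator 1 := fun i hi =>
      if_neg (Finset.mem_range.1 hi).ne
    have hk : f k = fun p => ENNReal.ofReal p.1 := if_pos rfl
    have hint (i : ℕ) : ∫⁻ ω, (f i ∘ Z i) ω ∂P = ∫⁻ p, f i p ∂(F.prod G) := by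
      rw [← hlaw i, lintegral_map (hf i) (mZ i)]
      rfl
    simp only [hint, Finset.prod_range_succ] at hprod
    rw [Finset.prod_congr rfl (g := fun _ => q) fun i hi => by
      rw [hne i hi, lintegral_indicator_one hmeas]] at hprod
    rw [Finset.prod_const, Finset.card_range, hk,
      lintegral_prod _ hfst.aemeasurable] at hprod
    simp only [lintegral_const, measure_univ, mul_one] at hprod
    rw [← hprod]
    refine lintegral_congr fun ω => ?_
    simp only [Function.comp_apply]
    congr 1
    exact Finset.prod_congr rfl fun i hi => by rw [hne i hi]
  rw [lintegral_tsum fun k => ?_]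
  · simp_rw [hterm]
    rw [ENNReal.tsum_mul_right, ENNReal.tsum_geometric]
    refine ENNReal.mul_lt_top (ENNReal.inv_lt_top.2 (tsub_pos_of_lt hq1)) ?_
    have := hF_mean.lintegral_lt_top
    exact this
  · refine (Measurable.mul ?_ (hfst.comp (mZ k))).aemeasurable
    exact Finset.measurable_prod _ fun i _ => hind.comp (mZ i)

/-- Going back from the origin until the first successful message bounds the relative age by a
sum of interarrival times. -/
lemma IsRegular.relativeAgeAtOrigin_le {τ σ : ℤ → ℝ} (h : IsRegular τ) (h0 : τ 0 ≤ 0) :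
    relativeAgeAtOrigin (fun n => (τ n, σ n)) ≤
      ∑' k : ℕ, (∏ i ∈ Finset.range k, {p : ℝ × ℝ | p.1 ≤ p.2}.indicator 1
        (τ (-(i + 1 : ℤ) + 1) - τ (-(i + 1 : ℤ)), σ (-(i + 1 : ℤ)))) *
        ENNReal.ofReal (τ (-(k + 1 : ℤ) + 1) - τ (-(k + 1 : ℤ))) := by
  -- As long as no success has occurred, the partial sums telescope.  If none ever occurs, they are
  -- unbounded, so that the right-hand side is `∞`.
  have hpartial (n : ℕ) (hn : ∀ i < n, τ (-(i + 1 : ℤ) + 1) - τ (-(i + 1 : ℤ)) ≤ σ (-(i + 1 : ℤ))) :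
      ENNReal.ofReal (τ 0 - τ (-(n + 1 : ℤ))) ≤
      ∑' k : ℕ, (∏ i ∈ Finset.range k, {p : ℝ × ℝ | p.1 ≤ p.2}.indicator 1
        (τ (-(i + 1 : ℤ) + 1) - τ (-(i + 1 : ℤ)), σ (-(i + 1 : ℤ)))) *
        ENNReal.ofReal (τ (-(k + 1 : ℤ) + 1) - τ (-(k + 1 : ℤ))) := by
    refine le_trans (le_of_eq ?_) (ENNReal.sum_le_tsum (Finset.range (n + 1)))
    rw [Finset.sum_congr rfl (g := fun k : ℕ =>
      ENNReal.ofReal (τ (-(k + 1 : ℤ) + 1) - τ (-(k + 1 : ℤ)))) fun k hk => ?_]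
    · rw [← ENNReal.ofReal_sum_of_nonneg fun k _ =>
        sub_nonneg.2 (h.strictMono.monotone (by omega))]
      congr 1
      have := Finset.sum_range_sub' (fun k : ℕ => τ (-(k : ℤ))) (n + 1)
      push_cast at this
      rw [neg_zero] at this
      rw [← this]
      refine Finset.sum_congr rfl fun k _ => ?_
      congr 2
      ring
    · rw [Finset.prod_eq_one fun i hi => ?_, one_mul]
      have := Finset.mem_range.1 hk
      have := Finset.mem_range.1 hi
      exact Set.indicator_of_mem (s := {p : ℝ × ℝ | p.1 ≤ p.2}) (hn i (by omega)) 1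
  by_cases hex : ∃ j : ℕ, σ (-(j + 1 : ℤ)) < τ (-(j + 1 : ℤ) + 1) - τ (-(j + 1 : ℤ))
  · classical
    refine le_trans ?_ (hpartial (Nat.find hex) fun i hi => not_lt.1 (Nat.find_min hex hi))
    have hj := Nat.find_spec hex
    set j := Nat.find hex
    refine (iInf_le _ (-(j + 1 : ℤ))).trans (if_pos ⟨?_, ?_⟩).le
    · change τ _ + σ _ < τ _
      linarith
    · change τ _ + σ _ ≤ 0
      have := h.strictMono.monotone (show -(j + 1 : ℤ) + 1 ≤ 0 by omega)
      linarith
  · push Not at hex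
    refine le_of_le_of_eq le_top (ENNReal.eq_top_of_forall_nnreal_le fun r => ?_).symm
    obtain ⟨N, hN⟩ := ((h.tendsto_atBot.eventually_le_atBot (τ 0 - r)).and
      (eventually_le_atBot (-1))).exists
    refine le_trans ?_ (hpartial (-N - 1).toNat fun i _ => hex i)
    rw [show -(((-N - 1).toNat : ℤ) + 1) = N by omega, ← ENNReal.ofReal_coe_nnreal]
    exact ENNReal.ofReal_le_ofReal (by linarith [hN.1])

namespace IsStationaryGIGI

variable {Ω : Type*} [MeasurableSpace Ω] {P : Measure Ω} {F G : Measure ℝ} {T S : ℤ → Ω → ℝ}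

/-! ### Laws of large numbers and almost sure regularity -/

lemma measurable_gap (h : IsStationaryGIGI P F G T S) (n : ℤ) :
    Measurable fun ω => T (n + 1) ω - T n ω :=
  (h.measurable_arrival (n + 1)).sub (h.measurable_arrival n)

lemma integral_comp_gap (h : IsStationaryGIGI P F G T S) {g : ℝ → ℝ} (hg : Measurable g) {n : ℤ}
    (hn : n ≠ 0) : ∫ ω, g (T (n + 1) ω - T n ω) ∂P = ∫ x, g x ∂F := by
  rw [← h.interarrival_law n hn,
    integral_map (h.measurable_gap n).aemeasurable hg.aestronglyMeasurable]

lemma ae_gap (h : IsStationaryGIGI P F G T S) {p : ℝ → Prop} (hp : ∀ᵐ x ∂F, p x) {n : ℤ}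
    (hn : n ≠ 0) : ∀ᵐ ω ∂P, p (T (n + 1) ω - T n ω) := by
  rw [← h.interarrival_law n hn] at hp
  exact ae_of_ae_map (h.measurable_gap n).aemeasurable hp

/-- The strong law of large numbers along any sequence of distinct interarrival intervals that do
not contain the origin. -/
lemma tendsto_average_gap (h : IsStationaryGIGI P F G T S) {g : ℝ → ℝ} (hg : Measurable g)
    (hint : Integrable g F) {e : ℕ → ℤ} (he : Function.Injective e) (he0 : ∀ k, e k ≠ 0) :
    ∀ᵐ ω ∂P, Tendsto (fun n : ℕ =>
      (∑ k ∈ Finset.range n, g (T (e k + 1) ω - T (e k) ω)) / n) atTop (𝓝 (∫ x, g x ∂F)) := by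
  have hident (k : ℕ) : IdentDistrib (fun ω => T (e k + 1) ω - T (e k) ω)
      (fun ω => T (e 0 + 1) ω - T (e 0) ω) P P :=
    ⟨(h.measurable_gap _).aemeasurable, (h.measurable_gap _).aemeasurable, by
      rw [h.interarrival_law _ (he0 k), h.interarrival_law _ (he0 0)]⟩
  have hslln := strong_law_ae_real (μ := P) (fun k ω => g (T (e k + 1) ω - T (e k) ω)) ?_ ?_
    fun k => (hident k).comp hg
  · rwa [h.integral_comp_gap hg (he0 0)] at hslln
  · rw [← h.interarrival_law _ (he0 0)] at hint
    exact hint.comp_measurable (h.measurable_gap _)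
  · intro i j hij
    have hne : (⟨e i, he0 i⟩ : {n : ℤ // n ≠ 0}) ≠ ⟨e j, he0 j⟩ := fun heq =>
      hij (he (congrArg Subtype.val heq))
    exact (h.interarrival_indep.indepFun hne).comp hg hg

lemma mean_pos [IsProbabilityMeasure F] (hF_pos : ∀ᵐ x ∂F, 0 < x)
    (hF_mean : Integrable (fun x : ℝ => x) F) : 0 < ∫ x, x ∂F := by
  rw [integral_pos_iff_support_of_nonneg_ae (hF_pos.mono fun x hx => hx.le) hF_mean]
  have : Function.support (fun x : ℝ => x) =ᵐ[F] Set.univ := by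
    filter_upwards [hF_pos] with x hx
    exact propext ⟨fun _ => trivial, fun _ => hx.ne'⟩
  rw [measure_congr this, measure_univ]
  exact one_pos

lemma ae_tendsto_arrival_div (h : IsStationaryGIGI P F G T S)
    (hF_mean : Integrable (fun x : ℝ => x) F) :
    ∀ᵐ ω ∂P, Tendsto (fun n : ℕ => T (n + 1) ω / n) atTop (𝓝 (∫ x, x ∂F)) := by
  filter_upwards [h.tendsto_average_gap measurable_id hF_mean (e := fun k => (k : ℤ) + 1)
    (fun i j hij => by simpa using hij) fun k => by omega] with ω hω
  have h0 := (tendsto_const_div_atTop_nhds_zero_nat (T 1 ω)).add hω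
  rw [zero_add] at h0
  refine h0.congr fun n => ?_
  have := Finset.sum_range_sub (fun k : ℕ => T ((k : ℤ) + 1) ω) n
  simp only [Nat.cast_zero, zero_add, Nat.cast_add, Nat.cast_one] at this
  simp only [id, this]
  ring

lemma ae_isRegular [IsProbabilityMeasure F] (h : IsStationaryGIGI P F G T S)
    (hF_pos : ∀ᵐ x ∂F, 0 < x) (hF_mean : Integrable (fun x : ℝ => x) F) :
    ∀ᵐ ω ∂P, IsRegular fun n => T n ω := by
  have hgap : ∀ᵐ ω ∂P, ∀ n : ℤ, T n ω < T (n + 1) ω := by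
    refine ae_all_iff.2 fun n => ?_
    by_cases hn : n = 0
    · subst hn
      filter_upwards [h.origin] with ω hω
      exact hω.1.trans_lt hω.2
    · filter_upwards [h.ae_gap hF_pos hn] with ω hω
      linarith
  have hm := mean_pos hF_pos hF_mean
  filter_upwards [hgap, h.ae_tendsto_arrival_div hF_mean,
    h.tendsto_average_gap measurable_id hF_mean (e := fun k => -((k : ℤ) + 1))
      (fun i j hij => by simpa using hij) fun k => by omega] with ω hω hright hleft
  have hmono : StrictMono fun n => T n ω := strictMono_int_of_lt_succ hω
  have hgrow (u : ℕ → ℝ) (hu : Tendsto (fun n : ℕ => u n / n) atTop (𝓝 (∫ x, x ∂F))) :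
      Tendsto u atTop atTop := by
    refine (hu.pos_mul_atTop hm tendsto_natCast_atTop_atTop).congr' ?_
    filter_upwards [eventually_ne_atTop 0] with n hn
    field_simp
  refine ⟨hmono, tendsto_atTop_atTop_of_monotone hmono.monotone fun b => ?_,
    tendsto_atBot_atBot_of_monotone hmono.monotone fun b => ?_⟩
  · obtain ⟨n, hn⟩ := ((hgrow _ hright).eventually_ge_atTop b).exists
    exact ⟨_, hn⟩
  · obtain ⟨n, hn⟩ := ((hgrow _ hleft).eventually_ge_atTop (T 0 ω - b)).exists
    refine ⟨-(n : ℤ), ?_⟩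
    have := Finset.sum_range_sub' (fun k : ℕ => T (-(k : ℤ)) ω) n
    simp only [Nat.cast_zero, neg_zero, Nat.cast_add, Nat.cast_one] at this
    have hsum : ∑ k ∈ Finset.range n, id (T (-((k : ℤ) + 1) + 1) ω - T (-((k : ℤ) + 1)) ω) =
        T 0 ω - T (-(n : ℤ)) ω := by
      rw [← this]
      refine Finset.sum_congr rfl fun k _ => ?_
      rw [show -((k : ℤ) + 1) + 1 = -(k : ℤ) by ring]
      rfl
    linarith

lemma ae_service_pos (h : IsStationaryGIGI P F G T S) (hG_pos : ∀ᵐ x ∂G, 0 < x) :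
    ∀ᵐ ω ∂P, ∀ n, 0 < S n ω := by
  refine ae_all_iff.2 fun n => ?_
  rw [← h.service_law n] at hG_pos
  exact ae_of_ae_map (h.measurable_service n).aemeasurable hG_pos

/-! ### The relative age has a finite mean -/

lemma lintegral_relativeAgeAtOrigin_lt_top [IsProbabilityMeasure F] [IsProbabilityMeasure G]
    (h : IsStationaryGIGI P F G T S)
    (hF_pos : ∀ᵐ x ∂F, 0 < x) (hF_mean : Integrable (fun x : ℝ => x) F)
    (hζ : 0 < (F.prod G) {p : ℝ × ℝ | p.2 < p.1}) :
    ∫⁻ ω, relativeAgeAtOrigin (fun n => (T n ω, S n ω)) ∂P < ∞ := by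
  let Z : ℕ → Ω → ℝ × ℝ := fun k ω =>
    (T (-(k + 1 : ℤ) + 1) ω - T (-(k + 1 : ℤ)) ω, S (-(k + 1 : ℤ)) ω)
  have mX (k : ℕ) : Measurable fun ω => T (-(k + 1 : ℤ) + 1) ω - T (-(k + 1 : ℤ)) ω :=
    h.measurable_gap _
  have mS (k : ℕ) : Measurable (S (-(k + 1 : ℤ))) := h.measurable_service _
  have hXS : IndepFun (fun ω (k : ℕ) => T (-(k + 1 : ℤ) + 1) ω - T (-(k + 1 : ℤ)) ω)
      (fun ω (k : ℕ) => S (-(k + 1 : ℤ)) ω) P := by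
    refine h.arrival_service_indep.comp
      (φ := fun (y : ℤ → ℝ) (k : ℕ) => y (-(k + 1 : ℤ) + 1) - y (-(k + 1 : ℤ)))
      (ψ := fun (y : ℤ → ℝ) (k : ℕ) => y (-(k + 1 : ℤ))) ?_ ?_ <;> fun_prop
  have hZ : iIndepFun Z P := by
    refine iIndepFun.prodMk_of_indepFun ?_ ?_ mX mS hXS
    · exact h.interarrival_indep.precomp
        (g := fun k : ℕ => (⟨-(k + 1 : ℤ), by omega⟩ : {n : ℤ // n ≠ 0}))
        fun i j hij => by simpa using hij
    · exact h.service_indep.precomp (g := fun k : ℕ => -(k + 1 : ℤ))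
        fun i j hij => by simpa using hij
  have hlaw (k : ℕ) : P.map (Z k) = F.prod G := by
    have := hZ.isProbabilityMeasure
    have hk := (hXS.comp (measurable_pi_apply k) (measurable_pi_apply k)).map_prod_eq_prod_map_map
      (mX k).aemeasurable (mS k).aemeasurable
    rw [← h.interarrival_law (-(k + 1 : ℤ)) (by omega), ← h.service_law (-(k + 1 : ℤ))]
    exact hk
  refine lt_of_le_of_lt (lintegral_mono_ae ?_) (lintegral_tsum_mul_prod_indicator_lt_top hF_mean hζ
    hZ (fun k => (mX k).prodMk (mS k)) hlaw)
  filter_upwards [h.ae_isRegular hF_pos hF_mean, h.origin] with ω hω h0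
  exact hω.relativeAgeAtOrigin_le h0.1

/-! ### The mean time since the last arrival -/

lemma identDistrib_elapsed [IsProbabilityMeasure F] (h : IsStationaryGIGI P F G T S)
    (hF_pos : ∀ᵐ x ∂F, 0 < x) (hF_mean : Integrable (fun x : ℝ => x) F) (t : ℝ) :
    IdentDistrib (fun ω => elapsed (fun n => T n ω) t) (fun ω => elapsed (fun n => T n ω) 0) P P := by
  have hmeas : Measurable fun y : ℤ → ℝ × ℝ => ENNReal.ofReal (-(y 0).1) :=
    (measurable_pi_apply 0).fst.neg.ennreal_ofReal
  have hseen (s : ℝ) : IdentDistrib (fun ω => elapsed (fun n => T n ω) s)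
      (fun ω => ENNReal.ofReal (-T 0 ω)) P P := by
    refine IdentDistrib.trans (IdentDistrib.of_ae_eq ?_ ?_) ((h.stationary s).comp hmeas)
    · exact (measurable_elapsed h.measurable_arrival measurable_const).aemeasurable
    · filter_upwards [h.ae_isRegular hF_pos hF_mean] with ω hω
      exact hω.elapsed_seenFrom (fun n => S n ω) s
  exact (hseen t).trans (hseen 0).symm

lemma integrable_truncReward [IsProbabilityMeasure F] (hF_pos : ∀ᵐ x ∂F, 0 < x)
    (hF_mean : Integrable (fun x : ℝ => x) F) {K : ℝ} (hK : 0 ≤ K) :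
    Integrable (truncReward K) F := by
  refine (hF_mean.const_mul K).mono' (continuous_truncReward K).aestronglyMeasurable ?_
  filter_upwards [hF_pos] with x hx
  rw [Real.norm_of_nonneg (truncReward_nonneg hK hx.le)]
  exact truncReward_le hx.le

/-- Renewal reward: the integral of the truncated elapsed time over `(0, n E X)`, divided by `n`,
converges to the mean reward of an interarrival interval. -/
lemma ae_tendsto_integral_truncElapsed_div [IsProbabilityMeasure F]
    (h : IsStationaryGIGI P F G T S)
    (hF_pos : ∀ᵐ x ∂F, 0 < x) (hF_mean : Integrable (fun x : ℝ => x) F) {K : ℝ} (hK : 0 ≤ K) :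
    ∀ᵐ ω ∂P, Tendsto
      (fun n : ℕ => (∫ t in (0 : ℝ)..n * ∫ x, x ∂F, truncElapsed K (fun n => T n ω) t) / n)
      atTop (𝓝 (∫ x, truncReward K x ∂F)) := by
  filter_upwards [h.ae_isRegular hF_pos hF_mean, h.ae_tendsto_arrival_div hF_mean,
    h.tendsto_average_gap (continuous_truncReward K).measurable
      (integrable_truncReward hF_pos hF_mean hK) (e := fun k => (k : ℤ) + 1)
      (fun i j hij => by simpa using hij) fun k => by omega] with ω hω hT hsum
  set m := ∫ x, x ∂F
  set τ := fun n => T n ω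
  have hint (a b : ℝ) := intervalIntegrable_truncElapsed hK τ a b
  have hsplit (n : ℕ) : (∫ t in (0 : ℝ)..n * m, truncElapsed K τ t) / n =
      (∫ t in (0 : ℝ)..τ 1, truncElapsed K τ t) / n +
      (∑ k ∈ Finset.range n, truncReward K (τ ((k + 1 : ℤ) + 1) - τ (k + 1))) / n +
      (∫ t in τ (n + 1)..n * m, truncElapsed K τ t) / n := by
    rw [← integral_truncElapsed_eq_sum hK hω.strictMono, ← add_div, ← add_div,
      intervalIntegral.integral_add_adjacent_intervals (hint _ _) (hint _ _),
      intervalIntegral.integral_add_adjacent_intervals (hint _ _) (hint _ _)]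
  have hrest : Tendsto (fun n : ℕ => (∫ t in τ (n + 1)..n * m, truncElapsed K τ t) / n)
      atTop (𝓝 0) := by
    have hbound : Tendsto (fun n : ℕ => K * |m - T (n + 1) ω / n|) atTop (𝓝 0) := by
      have := ((tendsto_const_nhds (x := m)).sub hT).abs.const_mul K
      simpa using this
    refine squeeze_zero_norm' ?_ hbound
    filter_upwards [eventually_gt_atTop 0] with n hn
    have hn' : (0 : ℝ) < n := Nat.cast_pos.2 hn
    rw [norm_div, Real.norm_of_nonneg hn'.le, div_le_iff₀ hn', mul_assoc]
    refine (intervalIntegral.norm_integral_le_of_norm_le_const fun t _ => ?_).trans_eq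
      (congrArg (K * ·) ?_)
    · rw [Real.norm_of_nonneg (truncElapsed_nonneg K τ t)]
      exact truncElapsed_le hK τ t
    · rw [← abs_of_pos hn', ← abs_mul, abs_of_pos hn']
      congr 1
      field_simp
      rfl
  have := ((tendsto_const_div_atTop_nhds_zero_nat
    (∫ t in (0 : ℝ)..τ 1, truncElapsed K τ t)).add hsum).add hrest
  rw [zero_add, add_zero] at this
  exact this.congr fun n => (hsplit n).symm

/-- By stationarity, the mean time average equals the mean at time `0`, so the renewal reward
limit determines the latter. -/
lemma mean_mul_integral_truncElapsed [IsProbabilityMeasure P] [IsProbabilityMeasure F]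
    (h : IsStationaryGIGI P F G T S)
    (hF_pos : ∀ᵐ x ∂F, 0 < x) (hF_mean : Integrable (fun x : ℝ => x) F) {K : ℝ} (hK : 0 ≤ K) :
    (∫ x, x ∂F) * ∫ ω, truncElapsed K (fun n => T n ω) 0 ∂P = ∫ x, truncReward K x ∂F := by
  set m := ∫ x, x ∂F with hm
  have hm0 : 0 < m := mean_pos hF_pos hF_mean
  have hjoint : Measurable fun p : ℝ × Ω => truncElapsed K (fun n => T n p.2) p.1 :=
    measurable_truncElapsed K (fun n => (h.measurable_arrival n).comp measurable_snd) measurable_fst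
  have hconst (t : ℝ) : ∫ ω, truncElapsed K (fun n => T n ω) t ∂P =
      ∫ ω, truncElapsed K (fun n => T n ω) 0 ∂P :=
    ((h.identDistrib_elapsed hF_pos hF_mean t).comp
      (measurable_id.min measurable_const).ennreal_toReal).integral_eq
  have hnorm (ω : Ω) (t : ℝ) : ‖truncElapsed K (fun n => T n ω) t‖ ≤ K := by
    rw [Real.norm_of_nonneg (truncElapsed_nonneg K _ t)]
    exact truncElapsed_le hK _ t
  have hmeas (L : ℝ) :
      Measurable fun ω => ∫ t in (0 : ℝ)..L, truncElapsed K (fun n => T n ω) t := by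
    have : StronglyMeasurable fun p : Ω × ℝ => truncElapsed K (fun n => T n p.1) p.2 :=
      (hjoint.comp measurable_swap).stronglyMeasurable
    simp only [intervalIntegral]
    exact (this.integral_prod_right (ν := volume.restrict (Set.Ioc 0 L))).measurable.sub
      (this.integral_prod_right (ν := volume.restrict (Set.Ioc L 0))).measurable
  have hswap (L : ℝ) : ∫ ω, (∫ t in (0 : ℝ)..L, truncElapsed K (fun n => T n ω) t) ∂P =
      L * ∫ ω, truncElapsed K (fun n => T n ω) 0 ∂P := by
    rw [← intervalIntegral_integral_swap (f := fun t ω => truncElapsed K (fun n => T n ω) t)]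
    · simp_rw [hconst]
      simp
    · have : IsFiniteMeasure (volume.restrict (Set.uIoc 0 L)) :=
        ⟨by simp [Set.uIoc]⟩
      exact Integrable.of_bound hjoint.aestronglyMeasurable K (ae_of_all _ fun p => hnorm p.2 p.1)
  have hlim := tendsto_integral_of_dominated_convergence (fun _ => K * m) (fun n : ℕ => ?_)
    (integrable_const _) (fun n => ae_of_all _ fun ω => ?_)
    (h.ae_tendsto_integral_truncElapsed_div hF_pos hF_mean hK)
  · rw [integral_const, probReal_univ, one_smul] at hlim
    refine tendsto_nhds_unique (tendsto_const_nhds.congr' ?_) hlim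
    filter_upwards [eventually_ne_atTop 0] with n hn
    rw [integral_div, hswap, ← hm]
    field_simp
  · exact ((hmeas _).div_const _).aestronglyMeasurable
  · rcases n.eq_zero_or_pos with rfl | hn
    · simp only [Nat.cast_zero, div_zero, norm_zero]
      positivity
    have hn' : (0 : ℝ) < n := Nat.cast_pos.2 hn
    rw [norm_div, Real.norm_of_nonneg hn'.le, div_le_iff₀ hn']
    refine (intervalIntegral.norm_integral_le_of_norm_le_const fun t _ => hnorm ω t).trans_eq ?_
    rw [sub_zero, abs_of_nonneg (by positivity)]
    ring

/-- The mean time elapsed since the last arrival is `E X² / (2 E X)`. -/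
lemma lintegral_elapsed [IsProbabilityMeasure P] [IsProbabilityMeasure F]
    (h : IsStationaryGIGI P F G T S)
    (hF_pos : ∀ᵐ x ∂F, 0 < x) (hF_mean : Integrable (fun x : ℝ => x) F) :
    ∫⁻ ω, elapsed (fun n => T n ω) 0 ∂P =
      (∫⁻ x, ENNReal.ofReal (x ^ 2) ∂F) / (2 * ∫⁻ x, ENNReal.ofReal x ∂F) := by
  have hmean : ∫⁻ x, ENNReal.ofReal x ∂F = ENNReal.ofReal (∫ x, x ∂F) :=
    (ofReal_integral_eq_lintegral_ofReal hF_mean (hF_pos.mono fun x hx => hx.le)).symm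
  have hm0 := mean_pos hF_pos hF_mean
  have helapsed : Measurable fun ω => elapsed (fun n => T n ω) 0 :=
    measurable_elapsed h.measurable_arrival measurable_const
  have htrunc (K : ℕ) : ENNReal.ofReal (∫ x, x ∂F) *
      ∫⁻ ω, min (elapsed (fun n => T n ω) 0) (ENNReal.ofReal K) ∂P =
      ∫⁻ x, ENNReal.ofReal (truncReward K x) ∂F := by
    have hK : (0 : ℝ) ≤ K := K.cast_nonneg
    rw [← ofReal_integral_eq_lintegral_ofReal (integrable_truncReward hF_pos hF_mean hK)
      (hF_pos.mono fun x hx => truncReward_nonneg hK hx.le),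
      ← h.mean_mul_integral_truncElapsed hF_pos hF_mean hK, ENNReal.ofReal_mul hm0.le,
      ofReal_integral_eq_lintegral_ofReal _ (ae_of_all _ fun ω => truncElapsed_nonneg _ _ _)]
    · simp_rw [ofReal_truncElapsed]
    · refine Integrable.of_bound
        (measurable_truncElapsed _ h.measurable_arrival measurable_const).aestronglyMeasurable K
        (ae_of_all _ fun ω => ?_)
      rw [Real.norm_of_nonneg (truncElapsed_nonneg _ _ _)]
      exact truncElapsed_le hK _ _
  have hleft : Tendsto (fun K : ℕ => ENNReal.ofReal (∫ x, x ∂F) *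
      ∫⁻ ω, min (elapsed (fun n => T n ω) 0) (ENNReal.ofReal K) ∂P) atTop
      (𝓝 (ENNReal.ofReal (∫ x, x ∂F) * ∫⁻ ω, elapsed (fun n => T n ω) 0 ∂P)) := by
    refine ENNReal.Tendsto.const_mul ?_ (Or.inr ENNReal.ofReal_ne_top)
    refine lintegral_tendsto_of_tendsto_of_monotone
      (fun K => (helapsed.min measurable_const).aemeasurable) (ae_of_all _ fun ω => ?_)
      (ae_of_all _ fun ω => ?_)
    · exact fun i j hij => min_le_min_left _ (ENNReal.ofReal_le_ofReal (Nat.cast_le.2 hij))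
    · have : Tendsto (fun K : ℕ => min (elapsed (fun n => T n ω) 0) (ENNReal.ofReal K)) atTop
          (𝓝 (min (elapsed (fun n => T n ω) 0) ∞)) :=
        tendsto_const_nhds.min (ENNReal.tendsto_ofReal_atTop.comp tendsto_natCast_atTop_atTop)
      simpa using this
  have hright : Tendsto (fun K : ℕ => ∫⁻ x, ENNReal.ofReal (truncReward K x) ∂F) atTop
      (𝓝 (∫⁻ x, ENNReal.ofReal (x ^ 2 / 2) ∂F)) := by
    refine lintegral_tendsto_of_tendsto_of_monotone
      (fun K => (continuous_truncReward K).measurable.ennreal_ofReal.aemeasurable) ?_ ?_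
    · filter_upwards [hF_pos] with x hx i j hij
      exact ENNReal.ofReal_le_ofReal (truncReward_mono (Nat.cast_le.2 hij) hx.le)
    · filter_upwards [hF_pos] with x hx
      refine tendsto_const_nhds.congr' ?_
      filter_upwards [tendsto_natCast_atTop_atTop.eventually_ge_atTop x] with K hK
      rw [truncReward_eq hx.le hK]
  have hkey := tendsto_nhds_unique hleft (by simpa only [htrunc] using hright)
  have hhalf : ∫⁻ x, ENNReal.ofReal (x ^ 2) ∂F = 2 * ∫⁻ x, ENNReal.ofReal (x ^ 2 / 2) ∂F := by
    rw [← lintegral_const_mul _ (by fun_prop)]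
    refine lintegral_congr fun x => ?_
    rw [← ENNReal.ofReal_ofNat, ← ENNReal.ofReal_mul (by norm_num)]
    congr 1
    ring
  rw [ENNReal.eq_div_iff (mul_ne_zero two_ne_zero (by simpa [hmean] using hm0))
    (ENNReal.mul_ne_top ENNReal.ofNat_ne_top (by simp [hmean])), hmean, mul_assoc, hkey, hhalf]

end IsStationaryGIGI

end PushOut

end

theorem corollary1 {Ω : Type*} [MeasurableSpace Ω] (P : Measure Ω) [IsProbabilityMeasure P]
    (F G : Measure ℝ) [IsProbabilityMeasure F] [IsProbabilityMeasure G]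
    (hF_pos : ∀ᵐ x ∂F, 0 < x) (hF_mean : Integrable (fun x : ℝ => x) F)
    (hG_pos : ∀ᵐ x ∂G, 0 < x) (hG_mean : Integrable (fun x : ℝ => x) G)
    (hζ : 0 < (F.prod G) {p : ℝ × ℝ | p.2 < p.1})
    (T S : ℤ → Ω → ℝ) (hTS : PushOut.IsStationaryGIGI P F G T S) :
    ∃ Δbar : ℝ≥0, ∀ t : ℝ,
      (∀ᵐ ω ∂P,
        0 ≤ PushOut.relativeAge (fun n => T n ω) (fun n => S n ω) t ∧
        0 ≤ PushOut.ageOfInformation (fun n => T n ω) (fun n => S n ω) t) ∧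
      ∫⁻ ω, ENNReal.ofReal (PushOut.relativeAge (fun n => T n ω) (fun n => S n ω) t) ∂P
        = (Δbar : ℝ≥0∞) ∧
      ∫⁻ ω, ENNReal.ofReal (PushOut.ageOfInformation (fun n => T n ω) (fun n => S n ω) t) ∂P
        = (Δbar : ℝ≥0∞)
          + (∫⁻ x, ENNReal.ofReal (x ^ 2) ∂F) / (2 * ∫⁻ x, ENNReal.ofReal x ∂F) := by
  have hfin := hTS.lintegral_relativeAgeAtOrigin_lt_top hF_pos hF_mean hζ
  refine ⟨(∫⁻ ω, PushOut.relativeAgeAtOrigin (fun n => (T n ω, S n ω)) ∂P).toNNReal, fun t => ?_⟩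
  rw [ENNReal.coe_toNNReal hfin.ne]
  have hident := (hTS.stationary t).comp PushOut.measurable_relativeAgeAtOrigin
  have hseen := hident.lintegral_eq
  simp only [Function.comp_apply] at hseen
  rw [← hseen] at hfin ⊢
  have hmeas : AEMeasurable (fun ω => PushOut.relativeAgeAtOrigin
      (PushOut.seenFrom (fun n => T n ω) (fun n => S n ω) t)) P := hident.aemeasurable_fst
  -- a finite mean forces a departure before `t`, almost surely
  have hspec : ∀ᵐ ω ∂P, PushOut.IsRegular (fun n => T n ω) ∧
      0 ≤ PushOut.relativeAge (fun n => T n ω) (fun n => S n ω) t ∧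
      ENNReal.ofReal (PushOut.relativeAge (fun n => T n ω) (fun n => S n ω) t) =
        PushOut.relativeAgeAtOrigin (PushOut.seenFrom (fun n => T n ω) (fun n => S n ω) t) := by
    filter_upwards [hTS.ae_isRegular hF_pos hF_mean, hTS.ae_service_pos hG_pos,
      ae_lt_top' hmeas hfin.ne] with ω hreg hpos hlt
    exact ⟨hreg, hreg.relativeAge_spec hpos hlt.ne⟩
  refine ⟨?_, lintegral_congr_ae (hspec.mono fun ω hω => hω.2.2), ?_⟩
  · filter_upwards [hspec] with ω hω
    exact ⟨hω.2.1, (hω.1.ageOfInformation_spec hω.2.1).1⟩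
  · rw [← hTS.lintegral_elapsed hF_pos hF_mean,
      ← (hTS.identDistrib_elapsed hF_pos hF_mean t).lintegral_eq, ← lintegral_add_left' hmeas]
    refine lintegral_congr_ae ?_
    filter_upwards [hspec] with ω hω
    rw [(hω.1.ageOfInformation_spec hω.2.1).2, hω.2.2]
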